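/- An ascent sequence of length $n\ge 1$ is a sequence $x=x_1x_2\cdots x_n$ of nonnegative integers with $x_1=0$ and $x_i\le 1+\mathrm{asc}(x_1\cdots x_{i-1})$ for $2\le i\le n$, where $\mathrm{asc}(s_1\cdots s_m)$ is the number of indices $1\le j\le m-1$ with $s_j<s_{j+1}$. The reduction of a word is obtained by replacing its $i$th smallest distinct letter by $i-1$, for every $i$; $x$ contains a pattern $p$ if some (not necessarily consecutive) subsequence of $x$ has reduction $p$, and otherwise $x$ avoids $p$. For a finite set $P$ of patterns let $a_P(n)$ be the number of ascent sequences of length $n$ that avoid every pattern in $P$; two sets $P,Q$ are Wilf-equivalent if $a_P(n)=a_Q(n)$ for all $n\ge 1$. Theorem. The pairs $\{0101,0112\}$, $\{0102,0112\}$, $\{0121,0112\}$ and $\{0102,0120\}$ are Wilf-equivalent. More precisely, for all $n\ge 1$, $$a_{\{0101,0112\}}(n)=a_{\{0102,0112\}}(n)=a_{\{0121,0112\}}(n)=a_{\{0102,0120\}}(n)=(n-1)2^{n-2}+1.$$ -/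

import Mathlib

namespace AscentSeq

/-- The number of ascents of `s`: positions `j` such that the letter at position `j` is smaller
than the next letter. -/
def asc (s : List ℕ) : ℕ :=
  ((Finset.range (s.length - 1)).filter (fun j => s.getD j 0 < s.getD (j + 1) 0)).card

/-- Ascent sequences (positions are counted from `0`): the first letter is `0`, and every later
letter is at most one more than the number of ascents of the prefix that precedes it. -/
def IsAscentSeq (x : List ℕ) : Prop :=
  ∀ i < x.length, (i = 0 → x.getD i 0 = 0) ∧ (1 ≤ i → x.getD i 0 ≤ 1 + asc (x.take i))

/-- The reduction of a word: the `i`-th smallest distinct letter is replaced by `i - 1`, that is,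
each letter is replaced by the number of distinct letters of the word that are smaller. -/
def red (w : List ℕ) : List ℕ :=
  w.map (fun a => (w.toFinset.filter (fun b => b < a)).card)

/-- `x` contains `p` if some (not necessarily consecutive) subsequence of `x` reduces to `p`. -/
def Contains (x p : List ℕ) : Prop :=
  ∃ s : List ℕ, s.Sublist x ∧ red s = p

/-- `x` avoids `p`. -/
def Avoids (x p : List ℕ) : Prop := ¬ Contains x p

/-- The set of ascent sequences of length `n` avoiding every pattern in `P`. -/
def avoiders (P : Finset (List ℕ)) (n : ℕ) : Set (List ℕ) :=
  {x | x.length = n ∧ IsAscentSeq x ∧ ∀ p ∈ P, Avoids x p}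

/-- The number of ascent sequences of length `n` avoiding every pattern in `P`. -/
noncomputable def numAvoiders (P : Finset (List ℕ)) (n : ℕ) : ℕ := (avoiders P n).ncard

/-- Wilf-equivalence of two finite sets of patterns. -/
def WilfEquiv (P Q : Finset (List ℕ)) : Prop :=
  ∀ n : ℕ, 1 ≤ n → numAvoiders P n = numAvoiders Q n

end AscentSeq

/-!
An ascent sequence that avoids `01012` is a restricted growth word: its letters first occur in the
order `0, 1, 2, …`. Indeed, in a restricted growth word the first occurrences of the letters
`1, 2, …` are tops of ascents, so the bound `1 + asc` can exceed the next unused letter only if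
some ascent `a < b` ends in a letter `b` that occurred before. Then `a b a b` occurs, because `a`
precedes the first `b`, and a letter that jumps over an unused one would complete `01012`
(`Grows.fresh_le_asc`, `IsAscentSeq.grows`). Conversely every restricted growth word is an ascent
sequence. Since `0101`, `0102` and `0112` are all contained in `01012`, each of the four
sets of avoiders consists of restricted growth words `0 w`, and the leading `0` simplifies the
patterns: a pattern `0 p` with `p` having positive letters only is avoided exactly when `w` has no
occurrence of `p` in positive letters.

The words `w` are then counted by deleting a first or a last letter.
* For `0112` and `0102` they are `0 ⋯ 0`, or `0 ⋯ 0 1 u v` with `v` a word in `0, 1` and `u` a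
  "mountain" `2 3 ⋯ m m ⋯ m ⋯ 2 ⋯ 2`; there are `2 ^ (n - 1)` mountains of length `n ≥ 1`
  (`encard_mountains`).
* For `0112` and `0101`, let `b` be the smallest positive letter that is repeated, if there is one.
  The word is a shuffle of zeros with `1 2 ⋯ (b-1)`, then a mountain from `b` up and back to `b`,
  then zeros.
* For `0112` and `0121` only the largest letter and `0` can be repeated; zeros are placed freely.
* For `0102` and `0120` the word is weakly increasing until it first descends, by one, from the
  largest letter `m`; from then on it is a word in `m - 1, m`.

In every case twice the number of words `w` of length `n` is `n 2 ^ n + 2`, which is the formula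
for length `n + 1`. Cardinalities are computed as `Set.encard`, so that finiteness of the sets is a
by-product of the recurrences (`numAvoiders_eq`).
-/

namespace AscentSeq

/-! ### Patterns as order relations -/

theorem lt_of_rank_lt {s : Finset ℕ} {a b : ℕ}
    (h : (s.filter (fun x => x < a)).card < (s.filter (fun x => x < b)).card) : a < b := by
  by_contra hab
  refine absurd h (not_lt.2 (Finset.card_le_card fun x hx => ?_))
  simp only [Finset.mem_filter] at hx ⊢
  exact ⟨hx.1, by omega⟩

theorem rank_lt {s : Finset ℕ} {a b : ℕ} (ha : a ∈ s) (h : a < b) :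
    (s.filter (fun x => x < a)).card < (s.filter (fun x => x < b)).card := by
  refine Finset.card_lt_card (Finset.ssubset_iff_of_subset ?_ |>.2 ⟨a, ?_, ?_⟩)
  · intro x hx
    simp only [Finset.mem_filter] at hx ⊢
    exact ⟨hx.1, by omega⟩
  · simp [ha, h]
  · simp

theorem eq_of_rank_eq {s : Finset ℕ} {a b : ℕ} (ha : a ∈ s) (hb : b ∈ s)
    (h : (s.filter (fun x => x < a)).card = (s.filter (fun x => x < b)).card) : a = b := by
  rcases lt_trichotomy a b with hab | hab | hab
  · exact absurd h (rank_lt ha hab).ne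
  · exact hab
  · exact absurd h (rank_lt hb hab).ne'

/-- A word reducing to a pattern of length four has four letters, whose ranks are the letters of
the pattern. -/
theorem exists_of_red_eq {s : List ℕ} {p q r t : ℕ} (h : red s = [p, q, r, t]) :
    ∃ a b c d : ℕ, s = [a, b, c, d] ∧ (p < q → a < b) ∧ (p < r → a < c) ∧ (p < t → a < d) ∧
      (q < r → b < c) ∧ (q < t → b < d) ∧ (r < t → c < d) ∧ (p = r → a = c) ∧ (p = t → a = d) ∧
      (q = r → b = c) ∧ (q = t → b = d) := by
  have hl : s.length = 4 := by simpa [red] using congrArg List.length h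
  obtain ⟨a, b, c, d, rfl⟩ : ∃ a b c d, s = [a, b, c, d] := by
    match s, hl with
    | [a, b, c, d], _ => exact ⟨a, b, c, d, rfl⟩
  simp only [red, List.map_cons, List.map_nil, List.cons.injEq, and_true] at h
  obtain ⟨rfl, rfl, rfl, rfl⟩ := h
  exact ⟨a, b, c, d, rfl, lt_of_rank_lt, lt_of_rank_lt, lt_of_rank_lt, lt_of_rank_lt,
    lt_of_rank_lt, lt_of_rank_lt, eq_of_rank_eq (by simp) (by simp),
    eq_of_rank_eq (by simp) (by simp), eq_of_rank_eq (by simp) (by simp),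
    eq_of_rank_eq (by simp) (by simp)⟩

theorem red_0101 {a b : ℕ} (h : a < b) : red [a, b, a, b] = [0, 1, 0, 1] := by
  simp [red, Finset.filter_insert, Finset.filter_singleton, h, h.not_gt]

theorem red_three {a b c : ℕ} (hab : a < b) (hbc : b < c) {s : List ℕ}
    (hs : s.toFinset = {a, b, c}) :
    red s = s.map (fun x => if x ≤ a then 0 else if x ≤ b then 1 else if x ≤ c then 2 else 3) := by
  refine List.map_congr_left fun x hx => ?_
  have hx' : x = a ∨ x = b ∨ x = c := by simpa [hs] using List.mem_toFinset.2 hx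
  rw [hs]
  have hac := hab.trans hbc
  rcases hx' with rfl | rfl | rfl <;>
    simp [Finset.filter_insert, Finset.filter_singleton, hab, hbc, hac, hab.not_gt, hbc.not_gt,
      hac.not_gt, hab.not_ge, hbc.not_ge, hac.not_ge, hab.ne]

theorem contains_0101 {x : List ℕ} :
    Contains x [0, 1, 0, 1] ↔ ∃ a b, a < b ∧ [a, b, a, b].Sublist x := by
  constructor
  · rintro ⟨s, hs, hred⟩
    obtain ⟨a, b, c, d, hs', h⟩ := exists_of_red_eq hred
    subst hs'
    clear hred
    norm_num at h
    obtain ⟨h1, -, -, rfl, rfl⟩ := h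
    exact ⟨a, b, h1, hs⟩
  · rintro ⟨a, b, h, hs⟩
    exact ⟨_, hs, red_0101 h⟩

theorem contains_0112 {x : List ℕ} :
    Contains x [0, 1, 1, 2] ↔ ∃ a b c, a < b ∧ b < c ∧ [a, b, b, c].Sublist x := by
  constructor
  · rintro ⟨s, hs, hred⟩
    obtain ⟨a, b, c, d, hs', h⟩ := exists_of_red_eq hred
    subst hs'
    clear hred
    norm_num at h
    obtain ⟨h1, -, -, h2, -, rfl⟩ := h
    exact ⟨a, b, d, h1, h2, hs⟩
  · rintro ⟨a, b, c, h1, h2, hs⟩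
    refine ⟨_, hs, ?_⟩
    rw [red_three h1 h2 (by ext; simp)]
    simp [h1.not_ge, h2.not_ge, (h1.trans h2).not_ge]

theorem contains_0102 {x : List ℕ} :
    Contains x [0, 1, 0, 2] ↔ ∃ a b c, a < b ∧ b < c ∧ [a, b, a, c].Sublist x := by
  constructor
  · rintro ⟨s, hs, hred⟩
    obtain ⟨a, b, c, d, hs', h⟩ := exists_of_red_eq hred
    subst hs'
    clear hred
    norm_num at h
    obtain ⟨h1, -, h2, -, rfl⟩ := h
    exact ⟨a, b, d, h1, h2, hs⟩
  · rintro ⟨a, b, c, h1, h2, hs⟩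
    refine ⟨_, hs, ?_⟩
    rw [red_three h1 h2 (by ext; simp; tauto)]
    simp [h1.not_ge, h2.not_ge, (h1.trans h2).not_ge]

theorem contains_0121 {x : List ℕ} :
    Contains x [0, 1, 2, 1] ↔ ∃ a b c, a < b ∧ b < c ∧ [a, b, c, b].Sublist x := by
  constructor
  · rintro ⟨s, hs, hred⟩
    obtain ⟨a, b, c, d, hs', h⟩ := exists_of_red_eq hred
    subst hs'
    clear hred
    norm_num at h
    obtain ⟨h1, -, -, h2, rfl⟩ := h
    exact ⟨a, b, c, h1, h2, hs⟩
  · rintro ⟨a, b, c, h1, h2, hs⟩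
    refine ⟨_, hs, ?_⟩
    rw [red_three h1 h2 (by ext; simp; tauto)]
    simp [h1.not_ge, h2.not_ge, (h1.trans h2).not_ge]

theorem contains_0120 {x : List ℕ} :
    Contains x [0, 1, 2, 0] ↔ ∃ a b c, a < b ∧ b < c ∧ [a, b, c, a].Sublist x := by
  constructor
  · rintro ⟨s, hs, hred⟩
    obtain ⟨a, b, c, d, hs', h⟩ := exists_of_red_eq hred
    subst hs'
    clear hred
    norm_num at h
    obtain ⟨h1, -, h2, rfl⟩ := h
    exact ⟨a, b, c, h1, h2, hs⟩
  · rintro ⟨a, b, c, h1, h2, hs⟩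
    refine ⟨_, hs, ?_⟩
    rw [red_three h1 h2 (by ext; simp; tauto)]
    simp [h1.not_ge, h2.not_ge, (h1.trans h2).not_ge]

/-! ### Restricted growth words -/

/-- `Grows k l`: a word whose set of letters so far is `{0, …, k - 1}` remains a restricted growth
word when `l` is written after it, that is, every letter of `l` exceeds the maximum of what
precedes it by at most one. The restricted growth words themselves are those with `Grows 0 l`. -/
def Grows : ℕ → List ℕ → Prop
  | _, [] => True
  | k, c :: l => (c < k ∧ Grows k l) ∨ (c = k ∧ Grows (k + 1) l)

/-- One more than the largest of `k - 1` and the letters of `l`: the next unused letter after a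
restricted growth word with letters `{0, …, k - 1}` has been continued by `l`. -/
def fresh (k : ℕ) (l : List ℕ) : ℕ := l.foldl (fun m c => max m (c + 1)) k

@[simp] theorem fresh_nil (k : ℕ) : fresh k [] = k := rfl

theorem fresh_concat (k : ℕ) (l : List ℕ) (c : ℕ) :
    fresh k (l ++ [c]) = max (fresh k l) (c + 1) := by simp [fresh]

theorem le_fresh (k : ℕ) (l : List ℕ) : k ≤ fresh k l := by
  induction l using List.reverseRecOn with
  | nil => simp
  | append_singleton l c ih => rw [fresh_concat]; omega

theorem lt_fresh_of_mem {k : ℕ} {l : List ℕ} {c : ℕ} (h : c ∈ l) : c < fresh k l := by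
  induction l using List.reverseRecOn with
  | nil => simp at h
  | append_singleton l d ih =>
    rw [fresh_concat]
    rcases List.mem_append.1 h with h | h
    · have := ih h; omega
    · have := List.mem_singleton.1 h; omega

theorem grows_concat {k : ℕ} {l : List ℕ} {c : ℕ} :
    Grows k (l ++ [c]) ↔ Grows k l ∧ c ≤ fresh k l := by
  induction l generalizing k with
  | nil => simp [Grows, le_iff_lt_or_eq]
  | cons d l ih =>
    have h1 : d < k → fresh k (d :: l) = fresh k l := fun h => by
      simp [fresh, max_eq_left (Nat.succ_le_of_lt h)]
    have h2 : d = k → fresh k (d :: l) = fresh (k + 1) l := fun h => by simp [fresh, h]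
    simp only [List.cons_append, Grows, ih]
    constructor
    · rintro (⟨h, h3, h4⟩ | ⟨h, h3, h4⟩)
      · exact ⟨.inl ⟨h, h3⟩, by rwa [h1 h]⟩
      · exact ⟨.inr ⟨h, h3⟩, by rwa [h2 h]⟩
    · rintro ⟨⟨h, h3⟩ | ⟨h, h3⟩, h4⟩
      · exact .inl ⟨h, h3, by rwa [h1 h] at h4⟩
      · exact .inr ⟨h, h3, by rwa [h2 h] at h4⟩

theorem grows_concat_of_le {k : ℕ} {l : List ℕ} {c : ℕ} (h : c ≤ k) :
    Grows k (l ++ [c]) ↔ Grows k l := by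
  rw [grows_concat, and_iff_left (h.trans (le_fresh k l))]

theorem grows_of_forall_lt {k : ℕ} {l : List ℕ} (h : ∀ x ∈ l, x < k) : Grows k l := by
  induction l with
  | nil => trivial
  | cons c l ih => exact .inl ⟨h c (by simp), ih fun x hx => h x (by simp [hx])⟩

theorem Grows.mem {l : List ℕ} (h : Grows 0 l) {b : ℕ} (hb : b < fresh 0 l) : b ∈ l := by
  induction l using List.reverseRecOn with
  | nil => simp at hb
  | append_singleton l c ih =>
    rw [grows_concat] at h
    rw [fresh_concat] at hb
    rw [List.mem_append, List.mem_singleton]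
    by_cases hb' : b < fresh 0 l
    · exact .inl (ih h.1 hb')
    · right; omega

/-- In a restricted growth word the letters first occur in increasing order. -/
theorem Grows.pair_sublist {l : List ℕ} (h : Grows 0 l) {a b : ℕ} (hab : a < b)
    (hb : b < fresh 0 l) : [a, b].Sublist l := by
  induction l using List.reverseRecOn with
  | nil => simp at hb
  | append_singleton l c ih =>
    rw [grows_concat] at h
    rw [fresh_concat] at hb
    by_cases hb' : b < fresh 0 l
    · exact (ih h.1 hb').trans (List.sublist_append_left _ _)
    · obtain rfl : b = c := by omega
      have : a ∈ l := h.1.mem (by omega)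
      exact (List.singleton_sublist.2 this).append (List.Sublist.refl [b])

/-! ### Ascent sequences avoiding `01012` are restricted growth words -/

theorem asc_concat_concat (l : List ℕ) (a c : ℕ) :
    asc (l ++ [a] ++ [c]) = asc (l ++ [a]) + if a < c then 1 else 0 := by
  have h1 : (l ++ [a] ++ [c]).length - 1 = ((l ++ [a]).length - 1) + 1 := by simp
  unfold asc
  rw [h1, Finset.range_add_one, Finset.filter_insert]
  have h2 : (l ++ [a] ++ [c]).getD ((l ++ [a]).length - 1) 0 = a := by simp
  have h3 : (l ++ [a] ++ [c]).getD ((l ++ [a]).length - 1 + 1) 0 = c := by simp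
  have h4 : (Finset.range ((l ++ [a]).length - 1)).filter
        (fun j => (l ++ [a] ++ [c]).getD j 0 < (l ++ [a] ++ [c]).getD (j + 1) 0) =
      (Finset.range ((l ++ [a]).length - 1)).filter
        (fun j => (l ++ [a]).getD j 0 < (l ++ [a]).getD (j + 1) 0) := by
    refine Finset.filter_congr fun j hj => ?_
    rw [Finset.mem_range] at hj
    rw [List.getD_append (l ++ [a]) _ _ _ (by omega),
      List.getD_append (l ++ [a]) _ _ _ (by omega)]
  rw [h2, h3, h4]
  split_ifs with h
  · rw [Finset.card_insert_of_notMem (by simp)]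
  · rfl

theorem isAscentSeq_concat {l : List ℕ} {c : ℕ} :
    IsAscentSeq (l ++ [c]) ↔
      IsAscentSeq l ∧ (l = [] → c = 0) ∧ (l ≠ [] → c ≤ 1 + asc l) := by
  have key : ∀ i < l.length, (l ++ [c]).getD i 0 = l.getD i 0 ∧ (l ++ [c]).take i = l.take i :=
    fun i hi => ⟨List.getD_append _ _ _ _ hi, List.take_append_of_le_length hi.le⟩
  have hlast : (l ++ [c]).getD l.length 0 = c := by simp
  have hpos : l ≠ [] ↔ 1 ≤ l.length := by rw [← List.length_pos_iff]; omega
  have hzero : l = [] ↔ l.length = 0 := by simp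
  have htake : (l ++ [c]).take l.length = l := by simp
  constructor
  · intro h
    refine ⟨fun i hi => ?_, ?_, ?_⟩
    · have := h i (by simp; omega)
      rwa [(key i hi).1, (key i hi).2] at this
    · have := h l.length (by simp)
      rw [hzero]; rw [hlast] at this
      exact this.1
    · have := h l.length (by simp)
      rw [hpos]; rw [hlast, htake] at this
      exact this.2
  · rintro ⟨h1, h2, h3⟩ i hi
    rcases Nat.lt_or_ge i l.length with hi' | hi'
    · rw [(key i hi').1, (key i hi').2]; exact h1 i hi'
    · obtain rfl : i = l.length := by simp at hi; omega
      rw [hlast, htake, ← hzero, ← hpos]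
      exact ⟨h2, h3⟩

/-- In a restricted growth word every first occurrence of a letter other than the first is the
top of an ascent, and any further ascent completes an occurrence of `0101`. -/
theorem Grows.fresh_le_asc {l : List ℕ} (h : Grows 0 l) (hl : l ≠ []) :
    fresh 0 l ≤ 1 + asc l ∧
      (fresh 0 l < 1 + asc l → ∃ a b, a < b ∧ [a, b, a, b].Sublist l) := by
  induction l using List.reverseRecOn with
  | nil => exact absurd rfl hl
  | append_singleton l c ih =>
    rw [grows_concat] at h
    obtain ⟨h1, h2⟩ := h
    rcases l.eq_nil_or_concat with rfl | ⟨l', a, rfl⟩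
    · simp at h2; subst h2; simp [fresh, asc]
    · obtain ⟨ih1, ih2⟩ := ih h1 (by simp)
      rw [List.concat_eq_append] at *
      have ha : a < fresh 0 (l' ++ [a]) := lt_fresh_of_mem (by simp)
      rw [asc_concat_concat, fresh_concat _ (l' ++ [a])]
      refine ⟨by split_ifs <;> omega, fun hlt => ?_⟩
      by_cases hold : fresh 0 (l' ++ [a]) < 1 + asc (l' ++ [a])
      · obtain ⟨p, q, hpq, hs⟩ := ih2 hold
        exact ⟨p, q, hpq, hs.trans (List.sublist_append_left _ _)⟩
      · split_ifs at hlt with hac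
        · refine ⟨a, c, hac, ?_⟩
          have hp := h1.pair_sublist hac (by omega)
          have hp' : [a, c].Sublist l' := by
            have := List.reverse_sublist.2 hp
            rw [← List.reverse_sublist]
            simp only [List.reverse_append, List.reverse_cons, List.reverse_nil, List.nil_append,
              List.cons_append] at this ⊢
            cases this with
            | cons _ h => exact h
            | cons_cons _ h => exact absurd hac (lt_irrefl _)
          exact (hp'.append (List.Sublist.refl [a])).append (List.Sublist.refl [c])
        · omega

theorem Grows.isAscentSeq {l : List ℕ} (h : Grows 0 l) : IsAscentSeq l := by
  induction l using List.reverseRecOn with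
  | nil => intro i hi; simp at hi
  | append_singleton l c ih =>
    rw [grows_concat] at h
    refine isAscentSeq_concat.2 ⟨ih h.1, ?_, fun hl => h.2.trans (h.1.fresh_le_asc hl).1⟩
    rintro rfl
    simpa using h.2

theorem IsAscentSeq.grows {l : List ℕ} (h : IsAscentSeq l)
    (hav : ∀ a b c, a < b → b < c → ¬ [a, b, a, b, c].Sublist l) : Grows 0 l := by
  induction l using List.reverseRecOn with
  | nil => trivial
  | append_singleton l c ih =>
    rw [isAscentSeq_concat] at h
    have hg := ih h.1 fun a b d hab hbd hs =>
      hav a b d hab hbd (hs.trans (List.sublist_append_left _ _))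
    refine grows_concat.2 ⟨hg, ?_⟩
    by_cases hl : l = []
    · simp [h.2.1 hl]
    · by_contra hc
      have hc' := h.2.2 hl
      obtain ⟨a, b, hab, hs⟩ := (hg.fresh_le_asc hl).2 (by omega)
      have hb : b < fresh 0 l := lt_fresh_of_mem (hs.subset (by simp))
      exact hav a b c hab (by omega) (hs.append (List.Sublist.refl [c]))

/-- When the ascent sequences satisfying `Q` avoid `01012`, those of positive length are the
restricted growth words satisfying `Q`; each of them starts with `0`. -/
theorem avoiders_succ {P : Finset (List ℕ)} {Q : List ℕ → Prop}
    (hP : ∀ x, (∀ p ∈ P, Avoids x p) ↔ Q x)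
    (hQ : ∀ x, Q x → ∀ a b c, a < b → b < c → ¬ [a, b, a, b, c].Sublist x) (n : ℕ) :
    avoiders P (n + 1) =
      (fun w => 0 :: w) '' {w | w.length = n ∧ Grows 1 w ∧ Q (0 :: w)} := by
  ext x
  simp only [avoiders, hP, Set.mem_ofPred_eq, Set.mem_image]
  constructor
  · rintro ⟨h1, h2, h3⟩
    have hg := h2.grows (hQ x h3)
    match x, h1, hg with
    | c :: w, h1, hg =>
      obtain ⟨hc, -⟩ | ⟨rfl, hg⟩ := hg
      · omega
      · exact ⟨w, ⟨by simpa using h1, hg, h3⟩, rfl⟩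
  · rintro ⟨w, ⟨h1, h2, h3⟩, rfl⟩
    exact ⟨by simp [h1], Grows.isAscentSeq (.inr ⟨rfl, h2⟩), h3⟩

/-! ### Counting words by recursion -/

theorem encard_image_cons (a : ℕ) (S : Set (List ℕ)) : ((fun w => a :: w) '' S).encard = S.encard :=
  Function.Injective.encard_image (fun _ _ h => (List.cons.inj h).2) S

theorem encard_image_concat (a : ℕ) (S : Set (List ℕ)) :
    ((fun w => w ++ [a]) '' S).encard = S.encard :=
  Function.Injective.encard_image (fun _ _ h => List.append_left_injective _ h) S

theorem disjoint_image_cons {a b : ℕ} (h : a ≠ b) (S T : Set (List ℕ)) :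
    Disjoint ((fun w => a :: w) '' S) ((fun w => b :: w) '' T) := by
  rw [Set.disjoint_left]
  rintro _ ⟨w, -, rfl⟩ ⟨v, -, hv⟩
  exact h (List.cons.inj hv).1.symm

theorem disjoint_image_concat {a b : ℕ} (h : a ≠ b) (S T : Set (List ℕ)) :
    Disjoint ((fun w => w ++ [a]) '' S) ((fun w => w ++ [b]) '' T) := by
  rw [Set.disjoint_left]
  rintro _ ⟨w, -, rfl⟩ ⟨v, -, hv⟩
  exact h (by simpa using (List.append_inj' hv rfl).2.symm)

/-- The recurrence behind three of the four counts. Here `z n` counts the continuations by `n`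
letters of a run of zeros and `u k n` those of a state reached once the letter `1` has been read
(the index `k` stands for the largest letter so far). In each state two letters lead to states of
the same kind, and the remaining continuations are `2 ^ n` in number. -/
theorem two_mul_eq_of_recurrence {z : ℕ → ℕ∞} {u : ℕ → ℕ → ℕ∞} (hu0 : ∀ k, u k 0 = 1)
    (hu : ∀ k n, u k (n + 1) = u k n + u (k + 1) n + 2 ^ n) (hz0 : z 0 = 1)
    (hz : ∀ n, z (n + 1) = z n + u 0 n) (n : ℕ) : 2 * z n = n * 2 ^ n + 2 := by
  have hu' : ∀ n k, 2 * u k n = (n + 2) * 2 ^ n := by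
    intro n
    induction n with
    | zero => intro k; simp [hu0]
    | succ n ih =>
      intro k
      rw [hu, mul_add, mul_add, ih, ih]
      push_cast
      ring
  induction n with
  | zero => simp [hz0]
  | succ n ih =>
    rw [hz, mul_add, ih, hu']
    push_cast
    ring

/-- The words of length `n` in the letters `p` and `q`. -/
def twoLetterWords (p q n : ℕ) : Set (List ℕ) := {w | w.length = n ∧ ∀ x ∈ w, x = p ∨ x = q}

theorem encard_twoLetterWords {p q : ℕ} (h : p ≠ q) (n : ℕ) :
    (twoLetterWords p q n).encard = 2 ^ n := by
  induction n with
  | zero =>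
    have : twoLetterWords p q 0 = {[]} := by
      ext w
      simp only [twoLetterWords, List.length_eq_zero_iff, Set.mem_ofPred_eq, Set.mem_singleton_iff]
      exact ⟨fun h => h.1, fun h => ⟨h, by simp [h]⟩⟩
    simp [this]
  | succ n ih =>
    have : twoLetterWords p q (n + 1) = (fun w => p :: w) '' twoLetterWords p q n ∪
        (fun w => q :: w) '' twoLetterWords p q n := by
      ext w
      cases w with
      | nil => simp [twoLetterWords]
      | cons d w =>
        simp only [twoLetterWords, List.length_cons, Nat.add_right_cancel_iff, List.mem_cons,
          forall_eq_or_imp, Set.mem_ofPred_eq, Set.mem_union, Set.mem_image, List.cons.injEq]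
        constructor
        · rintro ⟨h1, rfl | rfl, h2⟩
          · exact .inl ⟨w, ⟨h1, h2⟩, rfl, rfl⟩
          · exact .inr ⟨w, ⟨h1, h2⟩, rfl, rfl⟩
        · rintro (⟨_, ⟨h1, h2⟩, rfl, rfl⟩ | ⟨_, ⟨h1, h2⟩, rfl, rfl⟩)
          · exact ⟨h1, .inl rfl, h2⟩
          · exact ⟨h1, .inr rfl, h2⟩
    rw [this, Set.encard_union_eq (disjoint_image_cons h _ _), encard_image_cons,
      encard_image_cons, ih]
    ring

/-! ### Words in which no positive letter repeats before a larger one -/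

/-- No positive letter of `w` occurs twice before a larger letter. For restricted growth words
this says that `0112` is avoided. -/
def NoRepeatRise (w : List ℕ) : Prop := ∀ b c, 0 < b → b < c → ¬ [b, b, c].Sublist w

theorem NoRepeatRise.of_sublist {v w : List ℕ} (h : NoRepeatRise w) (hv : v.Sublist w) :
    NoRepeatRise v := fun b c hb hc hs => h b c hb hc (hs.trans hv)

theorem concat_sublist_concat {s w : List ℕ} {c d : ℕ} :
    (s ++ [c]).Sublist (w ++ [d]) ↔ (s ++ [c]).Sublist w ∨ c = d ∧ s.Sublist w := by
  rw [← List.reverse_sublist, ← List.reverse_sublist (l₂ := w),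
    ← List.reverse_sublist (l₁ := s) (l₂ := w)]
  simp only [List.reverse_append, List.reverse_cons, List.reverse_nil, List.nil_append,
    List.cons_append]
  constructor
  · intro h
    cases h with
    | cons _ h => exact .inl h
    | cons_cons _ h => exact .inr ⟨rfl, h⟩
  · rintro (h | ⟨rfl, h⟩)
    · exact h.cons _
    · exact h.cons_cons _

theorem noRepeatRise_concat {w : List ℕ} {d : ℕ} :
    NoRepeatRise (w ++ [d]) ↔
      NoRepeatRise w ∧ ∀ b, 0 < b → b < d → ¬ [b, b].Sublist w := by
  have key : ∀ b c, [b, b, c].Sublist (w ++ [d]) ↔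
      [b, b, c].Sublist w ∨ c = d ∧ [b, b].Sublist w := fun b c =>
    concat_sublist_concat (s := [b, b])
  constructor
  · intro h
    exact ⟨h.of_sublist (List.sublist_append_left _ _),
      fun b hb hd hs => h b d hb hd ((key _ _).2 (.inr ⟨rfl, hs⟩))⟩
  · rintro ⟨h1, h2⟩ b c hb hc hs
    rcases (key _ _).1 hs with h | ⟨rfl, h⟩
    · exact h1 b c hb hc h
    · exact h2 b hb hc h

theorem noRepeatRise_zero_cons {w : List ℕ} : NoRepeatRise (0 :: w) ↔ NoRepeatRise w := by
  refine ⟨fun h => h.of_sublist (List.sublist_cons_self _ _), fun h b c hb hc hs => ?_⟩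
  cases hs with
  | cons _ hs => exact h b c hb hc hs
  | cons_cons _ _ => exact absurd hb (lt_irrefl _)

theorem NoRepeatRise.cons_of_notMem {w : List ℕ} {d : ℕ} (h : NoRepeatRise w) (hd : d ∉ w) :
    NoRepeatRise (d :: w) := by
  intro b c hb hc hs
  cases hs with
  | cons _ hs => exact h b c hb hc hs
  | cons_cons _ hs => exact hd (hs.subset (by simp))

/-- The words `b (b+1) ⋯ m m ⋯ m (m-1) ⋯ (m-1) ⋯ b ⋯ b` of length `n`, each letter being allowed
any number of extra copies in the decreasing part. They are described here as the restricted
growth words in the letters `b, b+1, …` in which no letter repeats before a larger one; the empty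
word is included. -/
def mountains (b n : ℕ) : Set (List ℕ) :=
  {w | w.length = n ∧ (∀ x ∈ w, b ≤ x) ∧ Grows b w ∧ NoRepeatRise w}

theorem mountains_one (b : ℕ) : mountains b 1 = {[b]} := by
  ext w
  simp only [mountains, List.length_eq_one_iff, Set.mem_ofPred_eq, Set.mem_singleton_iff]
  constructor
  · rintro ⟨⟨a, rfl⟩, h1, h2, -⟩
    have := h1 a (by simp)
    simp only [Grows, and_true] at h2
    obtain rfl : a = b := by omega
    rfl
  · rintro rfl
    exact ⟨⟨b, rfl⟩, by simp, .inr ⟨rfl, trivial⟩, fun b c _ _ h => by simpa using h.length_le⟩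

/-- A mountain with at least two letters either ends in its smallest letter, which may be deleted,
or has that letter only at its start. -/
theorem mountains_add_two {b : ℕ} (hb : 0 < b) (n : ℕ) :
    mountains b (n + 2) = (fun w => b :: w) '' mountains (b + 1) (n + 1) ∪
      (fun w => w ++ [b]) '' mountains b (n + 1) := by
  ext w
  simp only [mountains, Set.mem_ofPred_eq, Set.mem_union, Set.mem_image]
  constructor
  · rintro ⟨h1, h2, h3, h4⟩
    obtain ⟨u, d, rfl⟩ : ∃ u d, w = u ++ [d] := by
      rcases w.eq_nil_or_concat with rfl | ⟨u, d, rfl⟩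
      · simp at h1
      · exact ⟨u, d, by simp⟩
    by_cases hd : d = b
    · subst hd
      exact .inr ⟨u, ⟨by simpa using h1, fun x hx => h2 x (by simp [hx]),
        (grows_concat_of_le le_rfl).1 h3, (noRepeatRise_concat.1 h4).1⟩, rfl⟩
    · left
      have hdb : b < d := lt_of_le_of_ne (h2 d (by simp)) (Ne.symm hd)
      match u, h1, h2, h3, h4 with
      | c :: u, h1, h2, h3, h4 =>
        have hc := h2 c (by simp)
        obtain ⟨hc', -⟩ | ⟨rfl, h3⟩ := h3
        · omega
        · refine ⟨u ++ [d], ⟨by simpa using h1, fun x hx => ?_, h3,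
            h4.of_sublist (List.sublist_cons_self _ _)⟩, rfl⟩
          refine lt_of_le_of_ne (h2 x (by simp at hx ⊢; tauto)) ?_
          rintro rfl
          have hxu : c ∈ u := by
            rcases List.mem_append.1 hx with h | h
            · exact h
            · simp at h; omega
          exact (noRepeatRise_concat.1 h4).2 c hb hdb
            ((List.singleton_sublist.2 hxu).cons_cons c)
  · rintro (⟨u, ⟨h1, h2, h3, h4⟩, rfl⟩ | ⟨u, ⟨h1, h2, h3, h4⟩, rfl⟩)
    · refine ⟨by simp [h1], ?_, .inr ⟨rfl, h3⟩, h4.cons_of_notMem fun h => ?_⟩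
      · simp only [List.mem_cons, forall_eq_or_imp, le_refl, true_and]
        exact fun x hx => (Nat.le_succ b).trans (h2 x hx)
      · have := h2 b h; omega
    · refine ⟨by simp [h1], ?_, (grows_concat_of_le le_rfl).2 h3, noRepeatRise_concat.2 ⟨h4, ?_⟩⟩
      · intro x hx
        rcases List.mem_append.1 hx with h | h
        · exact h2 x h
        · exact (List.mem_singleton.1 h).ge
      · intro a _ ha hs
        have := h2 a (hs.subset (by simp))
        omega

theorem encard_mountains {b : ℕ} (hb : 0 < b) (n : ℕ) : (mountains b (n + 1)).encard = 2 ^ n := by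
  induction n generalizing b with
  | zero => simp [mountains_one]
  | succ n ih =>
    have hd : Disjoint ((fun w => b :: w) '' mountains (b + 1) (n + 1))
        ((fun w => w ++ [b]) '' mountains b (n + 1)) := by
      rw [Set.disjoint_left]
      rintro _ ⟨w, hw, rfl⟩ ⟨v, hv, h⟩
      obtain ⟨u, d, rfl⟩ : ∃ u d, w = u ++ [d] := by
        rcases w.eq_nil_or_concat with rfl | ⟨u, d, rfl⟩
        · simp [mountains] at hw
        · exact ⟨u, d, by simp⟩
      have h' : v ++ [b] = (b :: u) ++ [d] := h
      have hbd : b = d := by simpa using (List.append_inj' h' rfl).2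
      have := hw.2.1 d (by simp)
      omega
    rw [mountains_add_two hb, Set.encard_union_eq hd, encard_image_cons, encard_image_concat,
      ih hb, ih (Nat.succ_pos b)]
    ring

/-! ### The pair `0102`, `0112` -/

/-- The continuations of `0 ⋯ 0 1` avoiding `0102` and `0112`. -/
def afterOne0102 (n : ℕ) : Set (List ℕ) :=
  {w | w.length = n ∧ Grows 2 w ∧ NoRepeatRise w ∧ ∀ b c, b < 2 → 1 < c → ¬ [b, c].Sublist w}

theorem afterOne0102_zero : afterOne0102 0 = {[]} := by
  ext w
  simp only [afterOne0102, List.length_eq_zero_iff, Set.mem_ofPred_eq, Set.mem_singleton_iff]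
  refine ⟨fun h => h.1, ?_⟩
  rintro rfl
  exact ⟨rfl, trivial, fun b c _ _ h => by simp at h, fun b c _ _ h => by simp at h⟩

/-- After `0 ⋯ 0 1` comes a mountain in the letters `2, 3, …`, then any word in `0` and `1`. -/
theorem afterOne0102_succ (n : ℕ) :
    afterOne0102 (n + 1) = (fun w => w ++ [0]) '' afterOne0102 n ∪
      (fun w => w ++ [1]) '' afterOne0102 n ∪ mountains 2 (n + 1) := by
  have hsmall : ∀ u d, d < 2 → (u ++ [d] ∈ afterOne0102 (n + 1) ↔ u ∈ afterOne0102 n) := by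
    intro u d hd
    have key : ∀ b c, [b, c].Sublist (u ++ [d]) ↔ [b, c].Sublist u ∨ c = d ∧ [b].Sublist u :=
      fun b c => concat_sublist_concat (s := [b])
    simp only [afterOne0102, List.length_append, List.length_singleton,
      Nat.add_right_cancel_iff, Set.mem_ofPred_eq, grows_concat_of_le hd.le, noRepeatRise_concat,
      key]
    constructor
    · rintro ⟨h1, h2, ⟨h3, -⟩, h4⟩
      exact ⟨h1, h2, h3, fun b c hb hc h => h4 b c hb hc (.inl h)⟩
    · rintro ⟨h1, h2, h3, h4⟩
      refine ⟨h1, h2, ⟨h3, fun b _ _ => by omega⟩, fun b c hb hc h => ?_⟩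
      rcases h with h | ⟨rfl, -⟩
      · exact h4 b c hb hc h
      · omega
  ext w
  simp only [Set.mem_union, Set.mem_image]
  constructor
  · intro hw
    obtain ⟨u, d, rfl⟩ : ∃ u d, w = u ++ [d] := by
      rcases w.eq_nil_or_concat with rfl | ⟨u, d, rfl⟩
      · simp [afterOne0102] at hw
      · exact ⟨u, d, by simp⟩
    rcases Nat.lt_or_ge d 2 with hd | hd
    · have hu := (hsmall u d hd).1 hw
      interval_cases d
      · exact .inl (.inl ⟨u, hu, rfl⟩)
      · exact .inl (.inr ⟨u, hu, rfl⟩)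
    · right
      refine ⟨hw.1, fun x hx => ?_, hw.2.1, hw.2.2.1⟩
      rcases List.mem_append.1 hx with h | h
      · by_contra hx2
        exact hw.2.2.2 x d (by omega) hd
          ((List.singleton_sublist.2 h).append (List.Sublist.refl [d]))
      · exact (List.mem_singleton.1 h).symm ▸ hd
  · rintro ((⟨u, hu, rfl⟩ | ⟨u, hu, rfl⟩) | ⟨h1, h2, h3, h4⟩)
    · exact (hsmall u 0 (by omega)).2 hu
    · exact (hsmall u 1 (by omega)).2 hu
    · refine ⟨h1, h3, h4, fun b c hb _ hs => ?_⟩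
      have := h2 b (hs.subset (by simp))
      omega

theorem encard_afterOne0102_succ (n : ℕ) : (afterOne0102 (n + 1)).encard =
    (afterOne0102 n).encard + (afterOne0102 n).encard + 2 ^ n := by
  have hd : Disjoint ((fun w => w ++ [0]) '' afterOne0102 n ∪
      (fun w => w ++ [1]) '' afterOne0102 n) (mountains 2 (n + 1)) := by
    rw [Set.disjoint_left]
    rintro _ (⟨u, -, rfl⟩ | ⟨u, -, rfl⟩) h
    · have := h.2.1 0 (by simp); omega
    · have := h.2.1 1 (by simp); omega
  rw [afterOne0102_succ, Set.encard_union_eq hd,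
    Set.encard_union_eq (disjoint_image_concat (by omega) _ _), encard_image_concat,
    encard_image_concat, encard_mountains (by omega)]

/-- The words `w` such that `0 w` is a restricted growth word avoiding `0102` and `0112`. -/
def afterZero0102 (n : ℕ) : Set (List ℕ) :=
  {w | w.length = n ∧ Grows 1 w ∧ NoRepeatRise w ∧ ∀ b c, 0 < b → b < c → ¬ [b, 0, c].Sublist w}

theorem afterZero0102_zero : afterZero0102 0 = {[]} := by
  ext w
  simp only [afterZero0102, List.length_eq_zero_iff, Set.mem_ofPred_eq, Set.mem_singleton_iff]
  refine ⟨fun h => h.1, ?_⟩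
  rintro rfl
  exact ⟨rfl, trivial, fun b c _ _ h => by simp at h, fun b c _ _ h => by simp at h⟩

theorem afterZero0102_succ (n : ℕ) :
    afterZero0102 (n + 1) = (fun w => 0 :: w) '' afterZero0102 n ∪
      (fun w => 1 :: w) '' afterOne0102 n := by
  ext w
  cases w with
  | nil => simp [afterZero0102]
  | cons d w =>
    simp only [afterZero0102, afterOne0102, List.length_cons, Nat.add_right_cancel_iff,
      Set.mem_ofPred_eq, Set.mem_union, Set.mem_image, List.cons.injEq]
    constructor
    · rintro ⟨h1, ⟨hd, h2⟩ | ⟨rfl, h2⟩, h3, h4⟩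
      · obtain rfl : d = 0 := by omega
        exact .inl ⟨w, ⟨h1, h2, noRepeatRise_zero_cons.1 h3,
          fun b c hb hc hs => h4 b c hb hc (hs.cons _)⟩, rfl, rfl⟩
      · refine .inr ⟨w, ⟨h1, h2, h3.of_sublist (List.sublist_cons_self _ _),
          fun b c hb hc hs => ?_⟩, rfl, rfl⟩
        interval_cases b
        · exact h4 1 c (by omega) hc (hs.cons_cons _)
        · exact h3 1 c (by omega) hc (hs.cons_cons _)
    · rintro (⟨w, ⟨h1, h2, h3, h4⟩, rfl, rfl⟩ | ⟨w, ⟨h1, h2, h3, h4⟩, rfl, rfl⟩)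
      · refine ⟨h1, .inl ⟨by omega, h2⟩, noRepeatRise_zero_cons.2 h3, fun b c hb hc hs => ?_⟩
        cases hs with
        | cons _ hs => exact h4 b c hb hc hs
        | cons_cons _ hs => exact absurd hb (lt_irrefl _)
      · refine ⟨h1, .inr ⟨rfl, h2⟩, fun b c hb hc hs => ?_, fun b c hb hc hs => ?_⟩
        · cases hs with
          | cons _ hs => exact h3 b c hb hc hs
          | cons_cons _ hs => exact h4 1 c (by omega) hc hs
        · have : [0, c].Sublist w := by
            cases hs with
            | cons _ hs => exact (List.sublist_cons_self _ _).trans hs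
            | cons_cons _ hs => exact hs
          exact h4 0 c (by omega) (by omega) this

theorem two_mul_encard_afterZero0102 (n : ℕ) :
    2 * (afterZero0102 n).encard = n * 2 ^ n + 2 := by
  refine two_mul_eq_of_recurrence (z := fun n => (afterZero0102 n).encard)
    (u := fun _ n => (afterOne0102 n).encard) ?_ (fun _ => encard_afterOne0102_succ) ?_ ?_ n
  · simp [afterOne0102_zero]
  · simp [afterZero0102_zero]
  · intro n
    rw [afterZero0102_succ, Set.encard_union_eq (disjoint_image_cons (by omega) _ _),
      encard_image_cons, encard_image_cons]

/-! ### The pair `0101`, `0112` -/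

/-- The continuations avoiding `0101` and `0112` of words in which each letter `1, …, b - 1` has
occurred exactly once, when none of these letters is to occur again. -/
def after0101 (b n : ℕ) : Set (List ℕ) :=
  {w | w.length = n ∧ (∀ x ∈ w, x = 0 ∨ b ≤ x) ∧ Grows b w ∧ NoRepeatRise w ∧
    ∀ c, 0 < c → ¬ [c, 0, c].Sublist w}

/-- The words of `after0101` that start with `b` and contain `b` once more. -/
def afterRepeat0101 (b n : ℕ) : Set (List ℕ) :=
  {w | w ∈ after0101 b n ∧ ∃ v, w = b :: v ∧ b ∈ v}

theorem after0101_zero (b : ℕ) : after0101 b 0 = {[]} := by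
  ext w
  simp only [after0101, List.length_eq_zero_iff, Set.mem_ofPred_eq, Set.mem_singleton_iff]
  refine ⟨fun h => h.1, ?_⟩
  rintro rfl
  exact ⟨rfl, by simp, trivial, fun b c _ _ h => by simp at h, fun c _ h => by simp at h⟩

theorem zero_cons_mem_after0101 {b n : ℕ} (hb : 0 < b) {w : List ℕ} :
    0 :: w ∈ after0101 b (n + 1) ↔ w ∈ after0101 b n := by
  simp only [after0101, List.length_cons, Nat.add_right_cancel_iff, Set.mem_ofPred_eq,
    List.mem_cons, forall_eq_or_imp, true_or, true_and, noRepeatRise_zero_cons]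
  have hg : Grows b (0 :: w) ↔ Grows b w := by simp [Grows, hb, hb.ne]
  rw [hg]
  refine and_congr_right fun _ => and_congr_right fun _ => and_congr_right fun _ =>
    and_congr_right fun _ => forall_congr' fun c => imp_congr_right fun hc => not_congr ?_
  constructor
  · intro hs
    cases hs with
    | cons _ hs => exact hs
    | cons_cons _ hs => exact absurd hc (lt_irrefl _)
  · exact fun hs => hs.cons _

theorem concat_zero_mem_after0101 {b n : ℕ} {w : List ℕ} :
    w ++ [0] ∈ after0101 b (n + 1) ↔ w ∈ after0101 b n := by
  have key : ∀ c, 0 < c → ([c, 0, c].Sublist (w ++ [0]) ↔ [c, 0, c].Sublist w) := fun c hc => by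
    refine (concat_sublist_concat (s := [c, 0])).trans (or_iff_left ?_)
    rintro ⟨h, -⟩
    omega
  simp only [after0101, List.length_append, List.length_singleton, Nat.add_right_cancel_iff,
    Set.mem_ofPred_eq, grows_concat_of_le (Nat.zero_le b), noRepeatRise_concat]
  constructor
  · rintro ⟨h1, h2, h3, ⟨h4, -⟩, h5⟩
    exact ⟨h1, fun x hx => h2 x (by simp [hx]), h3, h4,
      fun c hc h => h5 c hc ((key c hc).2 h)⟩
  · rintro ⟨h1, h2, h3, h4, h5⟩
    refine ⟨h1, fun x hx => ?_, h3, ⟨h4, fun b _ hb => absurd hb (Nat.not_lt_zero b)⟩,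
      fun c hc h => h5 c hc ((key c hc).1 h)⟩
    rcases List.mem_append.1 hx with h | h
    · exact h2 x h
    · exact .inl (List.mem_singleton.1 h)

theorem after0101_succ {b : ℕ} (hb : 0 < b) (n : ℕ) :
    after0101 b (n + 1) = (fun w => 0 :: w) '' after0101 b n ∪
      (fun w => b :: w) '' after0101 (b + 1) n ∪ afterRepeat0101 b (n + 1) := by
  ext w
  simp only [Set.mem_union, Set.mem_image]
  constructor
  · intro hw
    cases w with
    | nil => simp [after0101] at hw
    | cons d w =>
      obtain ⟨h1, h2, h3, h4, h5⟩ := id hw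
      have hd := h2 d (by simp)
      obtain ⟨hd', -⟩ | ⟨rfl, h3⟩ := h3
      · obtain rfl : d = 0 := by omega
        exact .inl (.inl ⟨w, (zero_cons_mem_after0101 hb).1 hw, rfl⟩)
      · by_cases hdw : d ∈ w
        · exact .inr ⟨hw, w, rfl, hdw⟩
        · refine .inl (.inr ⟨w, ⟨by simpa using h1, fun x hx => ?_, h3,
            h4.of_sublist (List.sublist_cons_self _ _), fun c hc hs => h5 c hc (hs.cons _)⟩, rfl⟩)
          have hx' := h2 x (by simp [hx])
          have : x ≠ d := by rintro rfl; exact hdw hx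
          omega
  · rintro ((⟨w, hw, rfl⟩ | ⟨w, ⟨h1, h2, h3, h4, h5⟩, rfl⟩) | hw)
    · exact (zero_cons_mem_after0101 hb).2 hw
    · have hbw : b ∉ w := fun h => by have := h2 b h; omega
      refine ⟨by simp [h1], ?_, .inr ⟨rfl, h3⟩, h4.cons_of_notMem hbw, fun c hc hs => ?_⟩
      · simp only [List.mem_cons, forall_eq_or_imp, le_refl, or_true, true_and]
        intro x hx
        have := h2 x hx
        omega
      · cases hs with
        | cons _ hs => exact h5 c hc hs
        | cons_cons _ hs => exact hbw (hs.subset (by simp))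
    · exact hw.1

theorem afterRepeat0101_one (b : ℕ) : afterRepeat0101 b 1 = ∅ := by
  refine Set.eq_empty_of_forall_notMem ?_
  rintro _ ⟨h, v, rfl, hv⟩
  have h1 := h.1
  simp only [List.length_cons, Nat.add_eq_right, List.length_eq_zero_iff] at h1
  simp [h1] at hv

/-- Once the letter `b` has been repeated, only zeros can follow its last occurrence, and what
precedes that occurrence is a mountain. -/
theorem afterRepeat0101_add_two {b : ℕ} (hb : 0 < b) (n : ℕ) :
    afterRepeat0101 b (n + 2) = (fun w => w ++ [0]) '' afterRepeat0101 b (n + 1) ∪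
      (fun w => w ++ [b]) '' mountains b (n + 1) := by
  ext w
  simp only [Set.mem_union, Set.mem_image]
  constructor
  · rintro ⟨hw, v, rfl, hv⟩
    obtain ⟨u, d, rfl⟩ : ∃ u d, v = u ++ [d] := by
      rcases v.eq_nil_or_concat with rfl | ⟨u, d, rfl⟩
      · simp at hv
      · exact ⟨u, d, by simp⟩
    rw [← List.cons_append] at hw ⊢
    by_cases hd : d = 0
    · subst hd
      exact .inl ⟨b :: u, ⟨concat_zero_mem_after0101.1 hw, u, rfl, by simpa [hb.ne'] using hv⟩, rfl⟩
    · right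
      obtain ⟨h1, h2, h3, h4, h5⟩ := hw
      have hbd : b = d := by
        have hd' := h2 d (by simp)
        by_contra hne
        have hbu : b ∈ u := by simpa [hne] using hv
        exact (noRepeatRise_concat.1 h4).2 b hb (by omega)
          ((List.singleton_sublist.2 hbu).cons_cons b)
      subst hbd
      refine ⟨b :: u, ⟨by simpa using h1, fun x hx => ?_, (grows_concat_of_le le_rfl).1 h3,
        (noRepeatRise_concat.1 h4).1⟩, rfl⟩
      rcases h2 x (List.mem_append_left _ hx) with rfl | h
      · have hxu : 0 ∈ u := by simpa [hb.ne] using hx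
        exact absurd (((List.singleton_sublist.2 hxu).cons_cons b).append (List.Sublist.refl [b]))
          (h5 b hb)
      · exact h
  · rintro (⟨u, ⟨hu, v, rfl, hv⟩, rfl⟩ | ⟨u, ⟨h1, h2, h3, h4⟩, rfl⟩)
    · exact ⟨concat_zero_mem_after0101.2 hu, v ++ [0], rfl, by simp [hv]⟩
    · match u, h1 with
      | c :: u, h1 =>
        have hc := h2 c (by simp)
        obtain rfl : c = b := by
          obtain ⟨h, -⟩ | ⟨h, -⟩ := h3
          · omega
          · exact h
        have hge : ∀ x ∈ c :: u ++ [c], c ≤ x := by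
          intro x hx
          rcases List.mem_append.1 hx with h | h
          · exact h2 x h
          · exact (List.mem_singleton.1 h).ge
        refine ⟨⟨by simpa using h1, fun x hx => .inr (hge x hx),
          (grows_concat_of_le le_rfl).2 h3, noRepeatRise_concat.2 ⟨h4, fun a _ ha hs => ?_⟩,
          fun a _ hs => ?_⟩, u ++ [c], rfl, by simp⟩
        · have := h2 a (hs.subset (by simp))
          omega
        · have := hge 0 (hs.subset (by simp))
          omega

theorem encard_afterRepeat0101 {b : ℕ} (hb : 0 < b) (n : ℕ) :
    (afterRepeat0101 b (n + 1)).encard + 1 = 2 ^ n := by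
  induction n with
  | zero => simp [afterRepeat0101_one]
  | succ n ih =>
    rw [afterRepeat0101_add_two hb, Set.encard_union_eq (disjoint_image_concat hb.ne _ _),
      encard_image_concat, encard_image_concat, encard_mountains hb, add_right_comm, ih]
    ring

theorem two_mul_encard_after0101 {b : ℕ} (hb : 0 < b) (n : ℕ) :
    2 * (after0101 b n).encard = n * 2 ^ n + 2 := by
  induction n generalizing b with
  | zero => simp [after0101_zero]
  | succ n ih =>
    have hd : Disjoint ((fun w => 0 :: w) '' after0101 b n ∪
        (fun w => b :: w) '' after0101 (b + 1) n) (afterRepeat0101 b (n + 1)) := by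
      rw [Set.disjoint_left]
      rintro _ (⟨w, -, rfl⟩ | ⟨w, hw, rfl⟩) ⟨-, v, h, hv⟩
      · have := (List.cons.inj h).1
        omega
      · obtain rfl := (List.cons.inj h).2
        have := hw.2.1 b hv
        omega
    rw [after0101_succ hb, Set.encard_union_eq hd,
      Set.encard_union_eq (disjoint_image_cons hb.ne _ _), encard_image_cons, encard_image_cons]
    refine ENat.add_left_injective_of_ne_top (n := 2) (by simp) ?_
    change 2 * _ + 2 = _ + 2
    calc _ = 2 * (after0101 b n).encard + 2 * (after0101 (b + 1) n).encard +
          2 * ((afterRepeat0101 b (n + 1)).encard + 1) := by ring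
      _ = _ := by
        rw [ih hb, ih (Nat.succ_pos b), encard_afterRepeat0101 hb]
        push_cast
        ring

/-! ### The pair `0121`, `0112` -/

theorem pair_sublist_range {a b k : ℕ} (hab : a < b) (hb : b < k) :
    [a, b].Sublist (List.range k) := by
  induction k with
  | zero => omega
  | succ k ih =>
    rw [List.range_succ]
    by_cases h : b < k
    · exact (ih h).trans (List.sublist_append_left _ _)
    · obtain rfl : b = k := by omega
      exact (List.singleton_sublist.2 (List.mem_range.2 hab)).append (List.Sublist.refl [b])

theorem count_range_append_le {k a : ℕ} {w : List ℕ} (h : a ∉ w) :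
    (List.range k ++ w).count a ≤ 1 := by
  rw [List.count_append, List.count_eq_zero_of_not_mem h]
  exact List.nodup_iff_count_le_one.1 List.nodup_range a

/-- No positive letter of `w` is repeated with a larger letter in between. For restricted growth
words this says that `0121` is avoided. -/
def NoReturn (w : List ℕ) : Prop := ∀ b c, 0 < b → b < c → ¬ [b, c, b].Sublist w

theorem append_zero_cons_iff {s u v : List ℕ} (hs : 0 ∉ s) :
    s.Sublist (u ++ 0 :: v) ↔ s.Sublist (u ++ v) := by
  constructor
  · intro h
    have h' := h.filter (fun x => x ≠ 0)
    have hs' : s.filter (fun x => x ≠ 0) = s :=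
      List.filter_eq_self.2 fun x hx => by
        simp only [ne_eq, decide_not, Bool.not_eq_eq_eq_not, Bool.not_true, decide_eq_false_iff_not]
        rintro rfl
        exact hs hx
    rw [hs'] at h'
    refine h'.trans ?_
    have : (u ++ 0 :: v).filter (fun x => x ≠ 0) = (u ++ v).filter (fun x => x ≠ 0) := by simp
    rw [this]
    exact List.filter_sublist
  · exact fun h => h.trans ((List.Sublist.refl u).append (List.sublist_cons_self _ _))

/-- The continuations of `0 1 ⋯ (k-1)` avoiding `0121` and `0112`. -/
def after0121 (k n : ℕ) : Set (List ℕ) :=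
  {w | w.length = n ∧ Grows k w ∧ NoRepeatRise (List.range k ++ w) ∧ NoReturn (List.range k ++ w)}

theorem not_sublist_range_of_two_le_count {s : List ℕ} {a k : ℕ} (h : 2 ≤ s.count a) :
    ¬ s.Sublist (List.range k) := fun hs => by
  have := hs.count_le a
  have := List.nodup_iff_count_le_one.1 (List.nodup_range (n := k)) a
  omega

theorem after0121_zero (k : ℕ) : after0121 k 0 = {[]} := by
  ext w
  simp only [after0121, List.length_eq_zero_iff, Set.mem_ofPred_eq, Set.mem_singleton_iff]
  refine ⟨fun h => h.1, ?_⟩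
  rintro rfl
  refine ⟨rfl, trivial, fun b c _ _ => ?_, fun b c _ _ => ?_⟩ <;>
    rw [List.append_nil] <;> exact not_sublist_range_of_two_le_count (a := b) (by simp)

theorem zero_cons_mem_after0121 {k n : ℕ} (hk : 0 < k) {w : List ℕ} :
    0 :: w ∈ after0121 k (n + 1) ↔ w ∈ after0121 k n := by
  have hg : Grows k (0 :: w) ↔ Grows k w := by simp [Grows, hk, hk.ne]
  have h1 : NoRepeatRise (List.range k ++ 0 :: w) ↔ NoRepeatRise (List.range k ++ w) :=
    forall_congr' fun b => forall_congr' fun c => imp_congr_right fun hb => imp_congr_right fun hc =>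
      not_congr (append_zero_cons_iff (by simp; omega))
  have h2 : NoReturn (List.range k ++ 0 :: w) ↔ NoReturn (List.range k ++ w) :=
    forall_congr' fun b => forall_congr' fun c => imp_congr_right fun hb => imp_congr_right fun hc =>
      not_congr (append_zero_cons_iff (by simp; omega))
  simp [after0121, hg, h1, h2]

theorem fresh_cons_mem_after0121 {k n : ℕ} {w : List ℕ} :
    k :: w ∈ after0121 k (n + 1) ↔ w ∈ after0121 (k + 1) n := by
  simp [after0121, Grows, List.range_succ]

/-- If a positive letter `d` already used is repeated, it has to be the largest letter so far, and
only `0` and `d` can follow. -/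
theorem repeat_cons_mem_after0121 {k n d : ℕ} (h0 : 0 < d) (hd : d < k) {w : List ℕ} :
    d :: w ∈ after0121 k (n + 1) ↔ d + 1 = k ∧ w ∈ twoLetterWords 0 d n := by
  constructor
  · rintro ⟨h1, -, h3, h4⟩
    have hdk : d + 1 = k := by
      by_contra hne
      obtain ⟨j, rfl⟩ := Nat.exists_eq_add_of_lt (show d + 1 < k by omega)
      refine h4 d (d + 1) h0 (by omega) (List.Sublist.append (l₁ := [d, d + 1]) (r₁ := [d]) ?_ ?_)
      · exact pair_sublist_range (by omega) (by omega)
      · simp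
    refine ⟨hdk, by simpa using h1, fun x hx => ?_⟩
    subst hdk
    by_contra! hx'
    rcases lt_trichotomy x d with h | h | h
    · refine h4 x d (by omega) h (List.Sublist.append (l₁ := [x, d]) (r₁ := [x]) ?_ ?_)
      · exact pair_sublist_range h (by omega)
      · simp [hx]
    · exact hx'.2 h
    · refine h3 d x h0 h (List.Sublist.append (l₁ := [d]) (r₁ := [d, x]) ?_ ?_)
      · simp
      · exact (List.singleton_sublist.2 hx).cons_cons d
  · rintro ⟨rfl, h1, h2⟩
    have hlt : ∀ x ∈ d :: w, x < d + 1 := by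
      simp only [List.mem_cons, forall_eq_or_imp, Nat.lt_succ_self, true_and]
      intro x hx
      have := h2 x hx
      omega
    have hall : ∀ x ∈ List.range (d + 1) ++ d :: w, x < d + 1 := by
      intro x hx
      rcases List.mem_append.1 hx with h | h
      · exact List.mem_range.1 h
      · exact hlt x h
    -- a letter strictly between `0` and `d` occurs only once
    have hone : ∀ (b c : ℕ) (s : List ℕ), 0 < b → b < c → c ∈ s → 2 ≤ s.count b →
        ¬ s.Sublist (List.range (d + 1) ++ d :: w) := by
      intro b c s hb hc hcs hcount hs
      have := hall c (hs.subset hcs)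
      have hbw : b ∉ d :: w := by
        simp only [List.mem_cons, not_or]
        refine ⟨by omega, fun h => ?_⟩
        have := h2 b h
        omega
      have := count_range_append_le (k := d + 1) hbw
      have := hs.count_le b
      omega
    exact ⟨by simp [h1], grows_of_forall_lt hlt,
      fun b c hb hc => hone b c _ hb hc (by simp) (by simp),
      fun b c hb hc => hone b c _ hb hc (by simp) (by simp)⟩

theorem after0121_one_succ (n : ℕ) :
    after0121 1 (n + 1) = (fun w => 0 :: w) '' after0121 1 n ∪
      (fun w => 1 :: w) '' after0121 2 n := by
  ext w
  simp only [Set.mem_union, Set.mem_image]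
  constructor
  · intro hw
    cases w with
    | nil => simp [after0121] at hw
    | cons d w =>
      obtain ⟨hd, -⟩ | ⟨rfl, -⟩ := hw.2.1
      · obtain rfl : d = 0 := by omega
        exact .inl ⟨w, (zero_cons_mem_after0121 (by omega)).1 hw, rfl⟩
      · exact .inr ⟨w, fresh_cons_mem_after0121.1 hw, rfl⟩
  · rintro (⟨w, hw, rfl⟩ | ⟨w, hw, rfl⟩)
    · exact (zero_cons_mem_after0121 (by omega)).2 hw
    · exact fresh_cons_mem_after0121.2 hw

theorem after0121_add_two_succ (k n : ℕ) :
    after0121 (k + 2) (n + 1) = (fun w => 0 :: w) '' after0121 (k + 2) n ∪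
      (fun w => (k + 2) :: w) '' after0121 (k + 3) n ∪
        (fun w => (k + 1) :: w) '' twoLetterWords 0 (k + 1) n := by
  ext w
  simp only [Set.mem_union, Set.mem_image]
  constructor
  · intro hw
    cases w with
    | nil => simp [after0121] at hw
    | cons d w =>
      obtain ⟨hd, -⟩ | ⟨rfl, -⟩ := hw.2.1
      · rcases Nat.eq_zero_or_pos d with rfl | hd0
        · exact .inl (.inl ⟨w, (zero_cons_mem_after0121 (by omega)).1 hw, rfl⟩)
        · obtain ⟨hd', hw'⟩ := (repeat_cons_mem_after0121 hd0 hd).1 hw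
          obtain rfl : d = k + 1 := by omega
          exact .inr ⟨w, hw', rfl⟩
      · exact .inl (.inr ⟨w, fresh_cons_mem_after0121.1 hw, rfl⟩)
  · rintro ((⟨w, hw, rfl⟩ | ⟨w, hw, rfl⟩) | ⟨w, hw, rfl⟩)
    · exact (zero_cons_mem_after0121 (by omega)).2 hw
    · exact fresh_cons_mem_after0121.2 hw
    · exact (repeat_cons_mem_after0121 (by omega) (by omega)).2 ⟨rfl, hw⟩

theorem two_mul_encard_after0121 (n : ℕ) :
    2 * (after0121 1 n).encard = n * 2 ^ n + 2 := by
  refine two_mul_eq_of_recurrence (z := fun n => (after0121 1 n).encard)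
    (u := fun k n => (after0121 (k + 2) n).encard) ?_ ?_ ?_ ?_ n
  · simp [after0121_zero]
  · intro k n
    rw [after0121_add_two_succ, Set.encard_union_eq, Set.encard_union_eq, encard_image_cons,
      encard_image_cons, encard_image_cons, encard_twoLetterWords (by omega)]
    · exact disjoint_image_cons (by omega) _ _
    · exact Set.disjoint_union_left.2
        ⟨disjoint_image_cons (by omega) _ _, disjoint_image_cons (by omega) _ _⟩
  · simp [after0121_zero]
  · intro n
    rw [after0121_one_succ, Set.encard_union_eq (disjoint_image_cons (by omega) _ _),
      encard_image_cons, encard_image_cons]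

/-! ### The pair `0102`, `0120` -/

/-- The word `w` contains neither `0102` nor `0120`. -/
def NoReturnBelow (w : List ℕ) : Prop :=
  ∀ a b c, a < b → b < c → ¬ [a, b, a, c].Sublist w ∧ ¬ [a, b, c, a].Sublist w

/-- Doubling a letter creates no new occurrence of a pattern without equal adjacent letters. -/
theorem append_cons_cons_iff {s u v : List ℕ} {d : ℕ} (hs : s.IsChain (· ≠ ·)) :
    s.Sublist (u ++ d :: d :: v) ↔ s.Sublist (u ++ d :: v) := by
  refine ⟨fun h => ?_, fun h => h.trans
    ((List.Sublist.refl u).append ((List.sublist_cons_self d v).cons_cons d))⟩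
  induction u generalizing s with
  | nil =>
    cases h with
    | cons _ h => exact h
    | cons_cons _ h =>
      cases h with
      | cons _ h => exact h.cons_cons _
      | cons_cons _ h => simp at hs
  | cons e u ih =>
    cases h with
    | cons _ h => exact (ih hs h).cons _
    | cons_cons _ h => exact (ih hs.tail h).cons_cons _

/-- The continuations of `0 1 ⋯ (k-1)` avoiding `0102` and `0120`. -/
def after0120 (k n : ℕ) : Set (List ℕ) :=
  {w | w.length = n ∧ Grows k w ∧ NoReturnBelow (List.range k ++ w)}

theorem after0120_zero (k : ℕ) : after0120 k 0 = {[]} := by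
  ext w
  simp only [after0120, List.length_eq_zero_iff, Set.mem_ofPred_eq, Set.mem_singleton_iff]
  refine ⟨fun h => h.1, ?_⟩
  rintro rfl
  refine ⟨rfl, trivial, fun a b c _ _ => ?_⟩
  rw [List.append_nil]
  exact ⟨not_sublist_range_of_two_le_count (a := a) (by simp),
    not_sublist_range_of_two_le_count (a := a) (by simp [List.count_cons]; omega)⟩

theorem last_cons_mem_after0120 {k n : ℕ} {w : List ℕ} :
    k :: w ∈ after0120 (k + 1) (n + 1) ↔ w ∈ after0120 (k + 1) n := by
  have hg : Grows (k + 1) (k :: w) ↔ Grows (k + 1) w := by simp [Grows]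
  have h : NoReturnBelow (List.range (k + 1) ++ k :: w) ↔
      NoReturnBelow (List.range (k + 1) ++ w) := by
    simp only [List.range_succ, List.append_assoc, List.singleton_append]
    refine forall_congr' fun a => forall_congr' fun b => forall_congr' fun c =>
      imp_congr_right fun hab => imp_congr_right fun hbc =>
        and_congr (not_congr (append_cons_cons_iff ?_)) (not_congr (append_cons_cons_iff ?_))
    · simp; omega
    · simp; omega
  simp [after0120, hg, h]

theorem fresh_cons_mem_after0120 {k n : ℕ} {w : List ℕ} :
    k :: w ∈ after0120 k (n + 1) ↔ w ∈ after0120 (k + 1) n := by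
  simp [after0120, Grows, List.range_succ]

/-- The first letter that descends has to be the second largest one, and only it and the largest
letter can follow. -/
theorem descent_cons_mem_after0120 {k n d : ℕ} (hd : d + 1 < k) {w : List ℕ} :
    d :: w ∈ after0120 k (n + 1) ↔ d + 2 = k ∧ w ∈ twoLetterWords d (d + 1) n := by
  constructor
  · rintro ⟨h1, -, h3⟩
    have hreturn : ∀ x, x + 2 < k → x ∉ d :: w := fun x hx hxw => by
      refine (h3 x (x + 1) (x + 2) (by omega) (by omega)).2
        (List.Sublist.append (l₁ := [x, x + 1, x + 2]) (r₁ := [x]) ?_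
          (List.singleton_sublist.2 hxw))
      refine List.Sublist.trans ?_ (List.range_sublist.2 (show x + 3 ≤ k by omega))
      rw [List.range_succ]
      exact (pair_sublist_range (by omega) (by omega)).append (List.Sublist.refl [x + 2])
    have hdk : d + 2 = k := by
      by_contra hne
      exact hreturn d (by omega) (by simp)
    refine ⟨hdk, by simpa using h1, fun x hx => ?_⟩
    by_contra! hx'
    rcases Nat.lt_or_ge x d with h | h
    · exact hreturn x (by omega) (by simp [hx])
    · refine (h3 d (d + 1) x (by omega) (by omega)).1
        (List.Sublist.append (l₁ := [d, d + 1]) (r₁ := [d, x]) ?_ ?_)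
      · exact pair_sublist_range (by omega) hd
      · exact (List.singleton_sublist.2 hx).cons_cons d
  · rintro ⟨rfl, h1, h2⟩
    have hmem : ∀ x ∈ d :: w, x = d ∨ x = d + 1 := by
      simpa using h2
    have hall : ∀ x ∈ List.range (d + 2) ++ d :: w, x < d + 2 := by
      intro x hx
      rcases List.mem_append.1 hx with h | h
      · exact List.mem_range.1 h
      · have := hmem x h
        omega
    -- a letter below the two largest ones occurs only once
    have hone : ∀ (a b c : ℕ) (s : List ℕ), a < b → b < c → c ∈ s → 2 ≤ s.count a →
        ¬ s.Sublist (List.range (d + 2) ++ d :: w) := by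
      intro a b c s hab hbc hcs hcount hs
      have := hall c (hs.subset hcs)
      have haw : a ∉ d :: w := fun h => by
        have := hmem a h
        omega
      have := count_range_append_le (k := d + 2) haw
      have := hs.count_le a
      omega
    exact ⟨by simp [h1], grows_of_forall_lt fun x hx => hall x (List.mem_append_right _ hx),
      fun a b c hab hbc => ⟨hone a b c _ hab hbc (by simp) (by simp),
        hone a b c _ hab hbc (by simp) (by simp [List.count_cons]; omega)⟩⟩

theorem after0120_one_succ (n : ℕ) :
    after0120 1 (n + 1) = (fun w => 0 :: w) '' after0120 1 n ∪
      (fun w => 1 :: w) '' after0120 2 n := by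
  ext w
  simp only [Set.mem_union, Set.mem_image]
  constructor
  · intro hw
    cases w with
    | nil => simp [after0120] at hw
    | cons d w =>
      obtain ⟨hd, -⟩ | ⟨rfl, -⟩ := hw.2.1
      · obtain rfl : d = 0 := by omega
        exact .inl ⟨w, last_cons_mem_after0120.1 hw, rfl⟩
      · exact .inr ⟨w, fresh_cons_mem_after0120.1 hw, rfl⟩
  · rintro (⟨w, hw, rfl⟩ | ⟨w, hw, rfl⟩)
    · exact last_cons_mem_after0120.2 hw
    · exact fresh_cons_mem_after0120.2 hw

theorem after0120_add_two_succ (k n : ℕ) :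
    after0120 (k + 2) (n + 1) = (fun w => (k + 1) :: w) '' after0120 (k + 2) n ∪
      (fun w => (k + 2) :: w) '' after0120 (k + 3) n ∪
        (fun w => k :: w) '' twoLetterWords k (k + 1) n := by
  ext w
  simp only [Set.mem_union, Set.mem_image]
  constructor
  · intro hw
    cases w with
    | nil => simp [after0120] at hw
    | cons d w =>
      obtain ⟨hd, -⟩ | ⟨rfl, -⟩ := hw.2.1
      · by_cases hdk : d = k + 1
        · subst hdk
          exact .inl (.inl ⟨w, last_cons_mem_after0120.1 hw, rfl⟩)
        · obtain ⟨hd', hw'⟩ := (descent_cons_mem_after0120 (by omega)).1 hw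
          obtain rfl : d = k := by omega
          exact .inr ⟨w, hw', rfl⟩
      · exact .inl (.inr ⟨w, fresh_cons_mem_after0120.1 hw, rfl⟩)
  · rintro ((⟨w, hw, rfl⟩ | ⟨w, hw, rfl⟩) | ⟨w, hw, rfl⟩)
    · exact last_cons_mem_after0120.2 hw
    · exact fresh_cons_mem_after0120.2 hw
    · exact (descent_cons_mem_after0120 (by omega)).2 ⟨rfl, hw⟩

theorem two_mul_encard_after0120 (n : ℕ) :
    2 * (after0120 1 n).encard = n * 2 ^ n + 2 := by
  refine two_mul_eq_of_recurrence (z := fun n => (after0120 1 n).encard)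
    (u := fun k n => (after0120 (k + 2) n).encard) ?_ ?_ ?_ ?_ n
  · simp [after0120_zero]
  · intro k n
    rw [after0120_add_two_succ, Set.encard_union_eq, Set.encard_union_eq, encard_image_cons,
      encard_image_cons, encard_image_cons, encard_twoLetterWords (by omega)]
    · exact disjoint_image_cons (by omega) _ _
    · exact Set.disjoint_union_left.2
        ⟨disjoint_image_cons (by omega) _ _, disjoint_image_cons (by omega) _ _⟩
  · simp [after0120_zero]
  · intro n
    rw [after0120_one_succ, Set.encard_union_eq (disjoint_image_cons (by omega) _ _),
      encard_image_cons, encard_image_cons]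

/-! ### From words to avoiders -/

/-- Prefixing the letter `0` turns the avoidance of `0112` into a condition on positive letters. -/
theorem avoids_0112_zero_cons {w : List ℕ} : Avoids (0 :: w) [0, 1, 1, 2] ↔ NoRepeatRise w := by
  rw [Avoids, contains_0112]
  constructor
  · exact fun h b c hb hc hs => h ⟨0, b, c, hb, hc, hs.cons_cons 0⟩
  · rintro h ⟨a, b, c, hab, hbc, hs⟩
    exact h b c (by omega) hbc hs.tail

theorem avoids_0121_zero_cons {w : List ℕ} : Avoids (0 :: w) [0, 1, 2, 1] ↔ NoReturn w := by
  rw [Avoids, contains_0121]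
  constructor
  · exact fun h b c hb hc hs => h ⟨0, b, c, hb, hc, hs.cons_cons 0⟩
  · rintro h ⟨a, b, c, hab, hbc, hs⟩
    exact h b c (by omega) hbc hs.tail

/-- An occurrence `a b a b` with `a > 0` contains `a a b`, which `0112` already excludes. -/
theorem avoids_0101_zero_cons {w : List ℕ} (hw : NoRepeatRise w) :
    Avoids (0 :: w) [0, 1, 0, 1] ↔ ∀ c, 0 < c → ¬ [c, 0, c].Sublist w := by
  rw [Avoids, contains_0101]
  constructor
  · exact fun h c hc hs => h ⟨0, c, hc, hs.cons_cons 0⟩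
  · rintro h ⟨a, b, hab, hs⟩
    rcases Nat.eq_zero_or_pos a with rfl | ha
    · exact h b hab hs.tail
    · cases hs with
      | cons _ hs =>
        exact hw a b ha hab (((List.sublist_cons_self b [a, b]).cons_cons a).trans hs)
      | cons_cons _ _ => exact absurd ha (lt_irrefl _)

/-- An occurrence `a b a c` with `a > 0` contains `a a c`, which `0112` already excludes. -/
theorem avoids_0102_zero_cons {w : List ℕ} (hw : NoRepeatRise w) :
    Avoids (0 :: w) [0, 1, 0, 2] ↔ ∀ b c, 0 < b → b < c → ¬ [b, 0, c].Sublist w := by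
  rw [Avoids, contains_0102]
  constructor
  · exact fun h b c hb hc hs => h ⟨0, b, c, hb, hc, hs.cons_cons 0⟩
  · rintro h ⟨a, b, c, hab, hbc, hs⟩
    rcases Nat.eq_zero_or_pos a with rfl | ha
    · exact h b c hab hbc hs.tail
    · cases hs with
      | cons _ hs =>
        exact hw a c ha (hab.trans hbc) (((List.sublist_cons_self b [a, c]).cons_cons a).trans hs)
      | cons_cons _ _ => exact absurd ha (lt_irrefl _)

theorem avoids_0102_and_0120 {w : List ℕ} :
    Avoids w [0, 1, 0, 2] ∧ Avoids w [0, 1, 2, 0] ↔ NoReturnBelow w := by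
  rw [Avoids, Avoids, contains_0102, contains_0120]
  constructor
  · exact fun h a b c hab hbc => ⟨fun hs => h.1 ⟨a, b, c, hab, hbc, hs⟩,
      fun hs => h.2 ⟨a, b, c, hab, hbc, hs⟩⟩
  · exact fun h => ⟨fun ⟨a, b, c, hab, hbc, hs⟩ => (h a b c hab hbc).1 hs,
      fun ⟨a, b, c, hab, hbc, hs⟩ => (h a b c hab hbc).2 hs⟩

theorem Avoids.no_01012_of_0112 {x : List ℕ} (h : Avoids x [0, 1, 1, 2]) (a b c : ℕ) (hab : a < b)
    (hbc : b < c) : ¬ [a, b, a, b, c].Sublist x := fun hs =>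
  h (contains_0112.2 ⟨a, b, c, hab, hbc,
    List.Sublist.trans (((List.sublist_cons_self a [b, c]).cons_cons b).cons_cons a) hs⟩)

theorem Avoids.no_01012_of_0102 {x : List ℕ} (h : Avoids x [0, 1, 0, 2]) (a b c : ℕ) (hab : a < b)
    (hbc : b < c) : ¬ [a, b, a, b, c].Sublist x := fun hs =>
  h (contains_0102.2 ⟨a, b, c, hab, hbc, List.Sublist.trans
    ((((List.sublist_cons_self b [c]).cons_cons a).cons_cons b).cons_cons a) hs⟩)

theorem avoiders_0101_0112 (n : ℕ) : avoiders {[0, 1, 0, 1], [0, 1, 1, 2]} (n + 1) =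
    (fun w => 0 :: w) '' after0101 1 n := by
  rw [avoiders_succ (Q := fun x => Avoids x [0, 1, 0, 1] ∧ Avoids x [0, 1, 1, 2]) (by simp)
    fun x h => h.2.no_01012_of_0112]
  congr 1
  ext w
  simp only [after0101, Set.mem_ofPred_eq, avoids_0112_zero_cons]
  have : ∀ x ∈ w, x = 0 ∨ 1 ≤ x := fun x _ => by omega
  constructor
  · rintro ⟨h1, h2, h3, h4⟩
    exact ⟨h1, this, h2, h4, (avoids_0101_zero_cons h4).1 h3⟩
  · rintro ⟨h1, -, h2, h4, h3⟩
    exact ⟨h1, h2, (avoids_0101_zero_cons h4).2 h3, h4⟩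

theorem avoiders_0102_0112 (n : ℕ) : avoiders {[0, 1, 0, 2], [0, 1, 1, 2]} (n + 1) =
    (fun w => 0 :: w) '' afterZero0102 n := by
  rw [avoiders_succ (Q := fun x => Avoids x [0, 1, 0, 2] ∧ Avoids x [0, 1, 1, 2]) (by simp)
    fun x h => h.2.no_01012_of_0112]
  congr 1
  ext w
  simp only [afterZero0102, Set.mem_ofPred_eq, avoids_0112_zero_cons]
  constructor
  · rintro ⟨h1, h2, h3, h4⟩
    exact ⟨h1, h2, h4, (avoids_0102_zero_cons h4).1 h3⟩
  · rintro ⟨h1, h2, h4, h3⟩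
    exact ⟨h1, h2, (avoids_0102_zero_cons h4).2 h3, h4⟩

theorem avoiders_0121_0112 (n : ℕ) : avoiders {[0, 1, 2, 1], [0, 1, 1, 2]} (n + 1) =
    (fun w => 0 :: w) '' after0121 1 n := by
  rw [avoiders_succ (Q := fun x => Avoids x [0, 1, 2, 1] ∧ Avoids x [0, 1, 1, 2]) (by simp)
    fun x h => h.2.no_01012_of_0112]
  congr 1
  ext w
  have hr : List.range 1 ++ w = 0 :: w := rfl
  have h : NoReturn (0 :: w) ↔ NoReturn w :=
    forall_congr' fun b => forall_congr' fun c => imp_congr_right fun hb => imp_congr_right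
      fun hc => not_congr (append_zero_cons_iff (u := []) (by simp; omega))
  simp only [after0121, Set.mem_ofPred_eq, avoids_0112_zero_cons, avoids_0121_zero_cons, hr, h,
    noRepeatRise_zero_cons, and_comm]

theorem avoiders_0102_0120 (n : ℕ) : avoiders {[0, 1, 0, 2], [0, 1, 2, 0]} (n + 1) =
    (fun w => 0 :: w) '' after0120 1 n := by
  rw [avoiders_succ (Q := fun x => Avoids x [0, 1, 0, 2] ∧ Avoids x [0, 1, 2, 0]) (by simp)
    fun x h => h.1.no_01012_of_0102]
  simp only [avoids_0102_and_0120]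
  rfl

theorem numAvoiders_eq {P : Finset (List ℕ)} {S : ℕ → Set (List ℕ)}
    (hP : ∀ n, avoiders P (n + 1) = (fun w => 0 :: w) '' S n)
    (hS : ∀ n, 2 * (S n).encard = n * 2 ^ n + 2) {n : ℕ} (hn : 1 ≤ n) :
    (numAvoiders P n : ℚ) = ((n : ℚ) - 1) * 2 ^ ((n : ℤ) - 2) + 1 := by
  obtain ⟨n, rfl⟩ := Nat.exists_eq_add_of_le' hn
  have h : 2 * (avoiders P (n + 1)).encard = n * 2 ^ n + 2 := by
    rw [hP, encard_image_cons, hS]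
  have hfin : (avoiders P (n + 1)).Finite := by
    rw [← Set.encard_ne_top_iff]
    intro htop
    rw [htop, ENat.mul_top (by simp)] at h
    exact absurd h.symm (by exact_mod_cast ENat.natCast_ne_top (n * 2 ^ n + 2))
  rw [← hfin.cast_ncard_eq] at h
  have h' : 2 * numAvoiders P (n + 1) = n * 2 ^ n + 2 := by exact_mod_cast h
  have hq : 2 * (numAvoiders P (n + 1) : ℚ) = n * 2 ^ n + 2 := by exact_mod_cast h'
  have hz : (2 : ℚ) ^ (((n + 1 : ℕ) : ℤ) - 2) = 2 ^ n / 2 := by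
    rw [show ((n + 1 : ℕ) : ℤ) - 2 = (n : ℤ) - 1 by push_cast; ring, zpow_sub_one₀ (by norm_num),
      zpow_natCast, div_eq_mul_inv]
  rw [hz]
  push_cast
  linarith

theorem wilfEquiv_of_formula {P Q : Finset (List ℕ)} {f : ℕ → ℚ}
    (hP : ∀ n, 1 ≤ n → (numAvoiders P n : ℚ) = f n)
    (hQ : ∀ n, 1 ≤ n → (numAvoiders Q n : ℚ) = f n) : WilfEquiv P Q := fun n hn => by
  exact_mod_cast (hP n hn).trans (hQ n hn).symm

end AscentSeq

theorem mainTheorem2 :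
    (AscentSeq.WilfEquiv {[0, 1, 0, 1], [0, 1, 1, 2]} {[0, 1, 0, 2], [0, 1, 1, 2]} ∧
      AscentSeq.WilfEquiv {[0, 1, 0, 2], [0, 1, 1, 2]} {[0, 1, 2, 1], [0, 1, 1, 2]} ∧
      AscentSeq.WilfEquiv {[0, 1, 2, 1], [0, 1, 1, 2]} {[0, 1, 0, 2], [0, 1, 2, 0]}) ∧
    ∀ n : ℕ, 1 ≤ n →
      (AscentSeq.numAvoiders {[0, 1, 0, 1], [0, 1, 1, 2]} n : ℚ)
          = ((n : ℚ) - 1) * 2 ^ ((n : ℤ) - 2) + 1 ∧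
      (AscentSeq.numAvoiders {[0, 1, 0, 2], [0, 1, 1, 2]} n : ℚ)
          = ((n : ℚ) - 1) * 2 ^ ((n : ℤ) - 2) + 1 ∧
      (AscentSeq.numAvoiders {[0, 1, 2, 1], [0, 1, 1, 2]} n : ℚ)
          = ((n : ℚ) - 1) * 2 ^ ((n : ℤ) - 2) + 1 ∧
      (AscentSeq.numAvoiders {[0, 1, 0, 2], [0, 1, 2, 0]} n : ℚ)
          = ((n : ℚ) - 1) * 2 ^ ((n : ℤ) - 2) + 1 := by
  have hA := fun n => AscentSeq.numAvoiders_eq (n := n) AscentSeq.avoiders_0101_0112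
    (AscentSeq.two_mul_encard_after0101 Nat.one_pos)
  have hB := fun n => AscentSeq.numAvoiders_eq (n := n) AscentSeq.avoiders_0102_0112
    AscentSeq.two_mul_encard_afterZero0102
  have hC := fun n => AscentSeq.numAvoiders_eq (n := n) AscentSeq.avoiders_0121_0112
    AscentSeq.two_mul_encard_after0121
  have hD := fun n => AscentSeq.numAvoiders_eq (n := n) AscentSeq.avoiders_0102_0120
    AscentSeq.two_mul_encard_after0120
  exact ⟨⟨AscentSeq.wilfEquiv_of_formula hA hB, AscentSeq.wilfEquiv_of_formula hB hC,
    AscentSeq.wilfEquiv_of_formula hC hD⟩, fun n hn => ⟨hA n hn, hB n hn, hC n hn, hD n hn⟩⟩
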